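/- Let $p$ and $q$ be distinct primes. For a finite abelian group $G$, call a subset $S\subseteq G$ a \emph{tile} if there is $T\subseteq G$ with $S+T=G$ and $|S|\cdot|T|=|G|$, and call $S$ \emph{spectral} if there is a set $\Lambda$ of characters of $G$ (homomorphisms from $G$ to the multiplicative group of $\mathbb{C}$) whose restrictions to $S$, indexed by $\Lambda$, form an orthogonal basis of the space of complex-valued functions on $S$, with respect to the inner product $\langle f,g\rangle=\sum_{x\in S}f(x)\overline{g(x)}$. Then Fuglede's conjecture holds on $\mathbb{Z}_p^2\times\mathbb{Z}_q$: a nonempty subset $S\subseteq\mathbb{Z}_p^2\times\mathbb{Z}_q$ is spectral if and only if it is a tile. -/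

import Mathlib

open scoped Pointwise ComplexConjugate

/-- `S` tiles the finite abelian group `G`: there is `T ⊆ G` with `S + T = G` and
`|S| * |T| = |G|`. -/
def IsTile {G : Type*} [AddCommGroup G] [Fintype G] [DecidableEq G] (S : Finset G) : Prop :=
  ∃ T : Finset G, S + T = Finset.univ ∧ S.card * T.card = Fintype.card G

/-- A set `L` of characters of `G` is a spectrum of `S`: the restrictions to `S` of the
characters in `L` form an orthogonal basis of the space of all complex functions on `S`,
with respect to the inner product given by summation over `S`. -/
structure IsSpectrum {G : Type*} [AddCommGroup G] (S : Finset G) (L : Set (AddChar G ℂ)) :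
    Prop where
  orthogonal : ∀ χ ∈ L, ∀ ψ ∈ L, χ ≠ ψ → ∑ x ∈ S, χ x * conj (ψ x) = 0
  linearIndependent : LinearIndependent ℂ (fun (χ : L) (x : S) => (χ : AddChar G ℂ) (x : G))
  span_eq_top : Submodule.span ℂ
    (Set.range (fun (χ : L) (x : S) => (χ : AddChar G ℂ) (x : G))) = ⊤

/-- `S` is spectral: it has a spectrum. -/
def IsSpectral {G : Type*} [AddCommGroup G] (S : Finset G) : Prop :=
  ∃ L : Set (AddChar G ℂ), IsSpectrum S L

/-! Both directions reduce to finding a subgroup `H` of the right order on which a character sum has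
no zero other than possibly at 0. If `S` has spectrum `I`, the sum over `I` vanishes at all nonzero
differences of `S`; so `H` meets `S - S` only in 0, the sum `S + H` is direct, and `S` tiles once
`#S * #H = #G` (`card_mul_card_le_of_sub_mem`). If `S + T` tiles, each nonzero point is a zero of
the transform of `S` or of `T`; if that of `T` has no zero on `H \ {0}` and `#H = #S`, then `H` is a
spectrum of `S` (`isSpectral_of_vanishes`).

Such an `H` is a product of 0, a line or the plane with 0 or `ZMod q`. Zeros on it are excluded by
divisibility: zeros filling `H \ {0}` force `#H ∣ #I` (`Vanishes.card_dvd`), and Galois invariance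
spreads one zero of prime order over its cyclic group. Zeros of order `p * q` are pushed down to
order `p` when `#I` is small (`Vanishes.left_of_dvd_card`, `Vanishes.left_of_card_lt`). -/

/-- The sum of the family `e` of characters over the index set `I` vanishes at `g`. -/
def Vanishes {X G : Type*} [AddCommGroup G] (I : Finset X) (e : X → AddChar G ℂ) (g : G) :
    Prop :=
  ∑ x ∈ I, e x g = 0

/-! ### Zeros of character sums: Galois invariance and divisibility -/

lemma AddChar.pow_eq_one_of_nsmul_eq_zero {G : Type*} [AddCommGroup G] (χ : AddChar G ℂ) {n : ℕ}
    {g : G} (hg : n • g = 0) : χ g ^ n = 1 := by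
  rw [← AddChar.map_nsmul_eq_pow, hg, AddChar.map_zero_eq_one]

lemma sum_range_inv_mul_pow {n : ℕ} {ω z : ℂ} (hn : n ≠ 0) (hω : ω ^ n = 1) (hz : z ^ n = 1) :
    ∑ l ∈ Finset.range n, (ω⁻¹ * z) ^ l = if z = ω then (n : ℂ) else 0 := by
  have hω0 : ω ≠ 0 := by
    rintro rfl
    simp [hn] at hω
  split_ifs with h
  · subst h
    simp [inv_mul_cancel₀ hω0]
  · have h1 : ω⁻¹ * z - 1 ≠ 0 := by
      intro h2
      apply h
      field_simp at h2
      linear_combination h2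
    have h2 := mul_geom_sum (ω⁻¹ * z) n
    rw [mul_pow, inv_pow, hω, hz] at h2
    simpa [h1] using h2

namespace Vanishes

variable {X G : Type*} [AddCommGroup G] {I : Finset X} {e : X → AddChar G ℂ}

/-- Galois invariance of the vanishing set. -/
lemma nsmul {g : G} (h : Vanishes I e g) {n k : ℕ} (hn : n ≠ 0) (hg : n • g = 0)
    (hk : k.Coprime n) : Vanishes I e (k • g) := by
  have : NeZero n := ⟨hn⟩
  have hζ := Complex.isPrimitiveRoot_exp n hn
  set ζ := Complex.exp (2 * Real.pi * Complex.I / n)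
  have hex (x : X) : ∃ i < n, ζ ^ i = e x g :=
    hζ.eq_pow_of_pow_eq_one ((e x).pow_eq_one_of_nsmul_eq_zero hg)
  choose a _ ha using hex
  -- The character sum is an integer polynomial evaluated at `ζ`; it is divisible by the minimal
  -- polynomial of `ζ`, which `ζ ^ k` shares.
  have h0 : Polynomial.aeval ζ (∑ x ∈ I, (Polynomial.X : Polynomial ℤ) ^ a x) = 0 := by
    simpa [ha, Vanishes] using h
  have h1 := minpoly.isIntegrallyClosed_dvd (hζ.isIntegral (Nat.pos_of_ne_zero hn)) h0
  rw [hζ.minpoly_eq_pow_coprime hk] at h1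
  have h2 := Polynomial.aeval_eq_zero_of_dvd_aeval_eq_zero h1 (minpoly.aeval ℤ (ζ ^ k))
  simp only [map_sum, map_pow, Polynomial.aeval_X] at h2
  unfold Vanishes
  rw [← h2]
  refine Finset.sum_congr rfl fun x _ => ?_
  rw [AddChar.map_nsmul_eq_pow, ← ha, ← pow_mul, ← pow_mul, mul_comm]

lemma of_mem_zmultiples [Finite G] {p : ℕ} [hp : Fact p.Prime] {g y : G} (hg : p • g = 0)
    (hy : y ∈ AddSubgroup.zmultiples g) (hy0 : y ≠ 0) (h : Vanishes I e y) : Vanishes I e g := by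
  obtain ⟨m, rfl⟩ := mem_multiples_iff_mem_zmultiples.2 hy
  change m • g ≠ 0 at hy0
  have hm : m.Coprime p := by
    refine (Nat.Prime.coprime_iff_not_dvd hp.out).2 ?_ |>.symm
    rintro ⟨c, rfl⟩
    exact hy0 (by rw [mul_comm, mul_nsmul', hg, nsmul_zero])
  obtain ⟨k, -, hk⟩ := Nat.exists_mul_mod_eq_one_of_coprime hm hp.out.one_lt
  have hkp : k.Coprime p := by
    refine (Nat.Prime.coprime_iff_not_dvd hp.out).2 ?_ |>.symm
    rintro ⟨c, rfl⟩
    rw [mul_left_comm, Nat.mul_mod_right] at hk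
    exact zero_ne_one hk
  have h3 := h.nsmul (k := k) (n := p) hp.out.ne_zero
    (by change p • m • g = 0; rw [nsmul_left_comm, hg, nsmul_zero]) hkp
  change Vanishes I e (k • m • g) at h3
  have h4 : k • m • g = g := by
    rw [← mul_nsmul, ← Nat.div_add_mod (m * k) p, hk, add_nsmul, mul_comm, mul_nsmul', hg]
    simp
  rwa [h4] at h3

/-- If the character sum vanishes on the nonzero elements of a subgroup, the order of the subgroup
divides the number of characters. -/
lemma card_dvd [Finite G] (H : AddSubgroup G) (h : ∀ g ∈ H, g ≠ 0 → Vanishes I e g) :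
    Nat.card H ∣ I.card := by
  classical
  have := Fintype.ofFinite G
  -- Summing over `H` in two ways: only `g = 0` contributes, while each character contributes `#H`
  -- or 0 according to whether it is trivial on `H`.
  have h1 : ∑ g : H, ∑ x ∈ I, e x g = I.card := by
    rw [Finset.sum_eq_single 0]
    · simp
    · exact fun g _ hg => h g g.2 (by simpa using hg)
    · simp
  rw [Finset.sum_comm] at h1
  have h2 (x : X) : ∑ g : H, e x g = if (e x).compAddMonoidHom H.subtype = 0 then
      (Fintype.card H : ℂ) else 0 :=
    AddChar.sum_eq_ite ((e x).compAddMonoidHom H.subtype)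
  simp only [h2] at h1
  rw [← Finset.sum_filter, Finset.sum_const, nsmul_eq_mul] at h1
  rw [Nat.card_eq_fintype_card]
  exact ⟨_, by rw [mul_comm]; exact_mod_cast h1.symm⟩

lemma prime_dvd_card [Finite G] {p : ℕ} [hp : Fact p.Prime] {g : G} (hg : p • g = 0) (hg0 : g ≠ 0)
    (h : Vanishes I e g) : p ∣ I.card := by
  rw [← addOrderOf_eq_prime hg hg0, ← Nat.card_zmultiples]
  refine card_dvd (e := e) _ fun y hy hy0 => ?_
  have hord : Nat.card (AddSubgroup.zmultiples g) = p := by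
    rw [Nat.card_zmultiples, addOrderOf_eq_prime hg hg0]
  have hyp : p • y = 0 := by
    obtain ⟨m, rfl⟩ := hy
    change p • m • g = 0
    rw [smul_comm, hg, smul_zero]
  refine of_mem_zmultiples hyp ?_ hg0 h
  have h1 : AddSubgroup.zmultiples y = AddSubgroup.zmultiples g := by
    refine AddSubgroup.eq_of_le_of_card_ge (AddSubgroup.zmultiples_le_of_mem hy) ?_
    rw [hord, Nat.card_zmultiples, addOrderOf_eq_prime hyp hy0]
  rw [h1]
  exact AddSubgroup.mem_zmultiples g

end Vanishes

/-! ### From zeros of order `p * q` to zeros of order `p` -/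

open Classical in
/-- Twisted character sums that vanish at the nonzero multiples of `b` have equal sums over the
fibres of evaluation at `b`. -/
lemma mul_sum_fiber_eq {X G : Type*} [AddCommGroup G] {I : Finset X} {e : X → AddChar G ℂ}
    {w : X → ℂ} {q : ℕ} (hq : q ≠ 0) {b : G} (hb : q • b = 0)
    (h : ∀ l, 0 < l → l < q → ∑ x ∈ I, w x * e x (l • b) = 0) {ω : ℂ} (hω : ω ^ q = 1) :
    q * ∑ x ∈ I with e x b = ω, w x = ∑ x ∈ I, w x := by
  have h1 : ∑ l ∈ Finset.range q, ω⁻¹ ^ l * ∑ x ∈ I, w x * e x (l • b) = ∑ x ∈ I, w x := by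
    rw [Finset.sum_eq_single 0]
    · simp
    · intro l hl hl0
      rw [h l (Nat.pos_of_ne_zero hl0) (Finset.mem_range.1 hl), mul_zero]
    · simp [hq]
  rw [← h1]
  simp only [Finset.mul_sum]
  rw [Finset.sum_comm, Finset.sum_filter]
  refine Finset.sum_congr rfl fun x _ => ?_
  have h2 := sum_range_inv_mul_pow hq hω ((e x).pow_eq_one_of_nsmul_eq_zero hb)
  have h3 : ∑ l ∈ Finset.range q, ω⁻¹ ^ l * (w x * e x (l • b)) =
      w x * ∑ l ∈ Finset.range q, (ω⁻¹ * e x b) ^ l := by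
    rw [Finset.mul_sum]
    refine Finset.sum_congr rfl fun l _ => ?_
    rw [AddChar.map_nsmul_eq_pow, mul_pow]
    ring
  rw [h3, h2]
  split_ifs <;> ring

open Classical in
lemma sum_range_sum_eq_mul_card {X G : Type*} [AddCommGroup G] (I : Finset X)
    (e : X → AddChar G ℂ) {p : ℕ} (hp : p ≠ 0) {a : G} (ha : p • a = 0) :
    ∑ l ∈ Finset.range p, ∑ x ∈ I, e x (l • a) = p * (I.filter fun x => e x a = 1).card := by
  rw [Finset.sum_comm, Finset.card_filter]
  push_cast
  rw [Finset.mul_sum]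
  refine Finset.sum_congr rfl fun x _ => ?_
  have h2 := sum_range_inv_mul_pow hp (one_pow p) ((e x).pow_eq_one_of_nsmul_eq_zero ha)
  simp only [inv_one, one_mul, ← AddChar.map_nsmul_eq_pow] at h2
  rw [h2]
  split_ifs <;> simp

namespace Vanishes

variable {X G : Type*} [AddCommGroup G] {I : Finset X} {e : X → AddChar G ℂ}
  {p q : ℕ} [hp : Fact p.Prime] [hq : Fact q.Prime]

/-- By the Chinese remainder theorem a single multiplier, prime to `p * q`, acts as `k` on `a` and
as `l` on `b`; Galois invariance applies to it. -/
lemma nsmul_add_nsmul (hpq : p ≠ q) {a b : G} (ha : p • a = 0) (hb : q • b = 0)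
    (h : Vanishes I e (a + b)) {k l : ℕ} (hk0 : 0 < k) (hk : k < p) (hl0 : 0 < l) (hl : l < q) :
    Vanishes I e (k • a + l • b) := by
  have hco : p.Coprime q := (Nat.coprime_primes hp.out hq.out).2 hpq
  obtain ⟨m, hm1, hm2⟩ := Nat.chineseRemainder hco k l
  have key {n : ℕ} {c : G} (hc : n • c = 0) {r : ℕ} (hr : m ≡ r [MOD n]) : m • c = r • c := by
    rw [← Nat.div_add_mod m n, ← Nat.div_add_mod r n, hr, add_nsmul, add_nsmul,
      mul_comm n, mul_comm n, mul_nsmul', mul_nsmul', hc]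
    simp
  have h1 := h.nsmul (n := p * q) (k := m) (mul_ne_zero hp.out.ne_zero hq.out.ne_zero) ?_ ?_
  · rwa [nsmul_add, key ha hm1, key hb hm2] at h1
  · rw [nsmul_add, mul_nsmul, ha, mul_nsmul', hb]
    simp
  · refine Nat.Coprime.mul_right ?_ ?_
    · rw [Nat.Coprime, hm1.gcd_eq]
      exact (hp.out.coprime_iff_not_dvd.2 (Nat.not_dvd_of_pos_of_lt hk0 hk)).symm
    · rw [Nat.Coprime, hm2.gcd_eq]
      exact (hq.out.coprime_iff_not_dvd.2 (Nat.not_dvd_of_pos_of_lt hl0 hl)).symm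

open Classical in
lemma mul_sum_fiber (hpq : p ≠ q) {a b : G} (ha : p • a = 0) (hb : q • b = 0)
    (h : Vanishes I e (a + b)) {k : ℕ} (hk0 : 0 < k) (hk : k < p) {ω : ℂ} (hω : ω ^ q = 1) :
    q * ∑ x ∈ I with e x b = ω, e x (k • a) = ∑ x ∈ I, e x (k • a) := by
  refine mul_sum_fiber_eq hq.out.ne_zero hb (fun l hl0 hl => ?_) hω
  have h1 := h.nsmul_add_nsmul hpq ha hb hk0 hk hl0 hl
  simpa [Vanishes, AddChar.map_add_eq_mul] using h1

lemma left_of_fiber_eq_empty (hpq : p ≠ q) {a b : G} (ha : p • a = 0) (hb : q • b = 0)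
    (h : Vanishes I e (a + b)) {ω : ℂ} (hω : ω ^ q = 1) (hempty : ∀ x ∈ I, e x b ≠ ω) :
    Vanishes I e a := by
  classical
  have h1 := h.mul_sum_fiber hpq ha hb one_pos hp.out.one_lt hω
  rw [Finset.filter_false_of_mem hempty] at h1
  simpa [Vanishes, eq_comm] using h1

lemma exists_fiber_card_lt (b : G) {m : ℕ} (hI : I.card < q * m) :
    ∃ ω : ℂ, ω ^ q = 1 ∧ ∀ J ⊆ I, (∀ x ∈ J, e x b = ω) → J.card < m := by
  classical
  have hq0 := hq.out.pos
  have hmem (ω : ℂ) : ω ∈ Polynomial.nthRootsFinset q (1 : ℂ) ↔ ω ^ q = 1 :=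
    Polynomial.mem_nthRootsFinset hq0 1
  have hcard : (Polynomial.nthRootsFinset q (1 : ℂ)).card = q :=
    (Complex.isPrimitiveRoot_exp q hq0.ne').card_nthRootsFinset
  obtain ⟨ω, hω, hlt⟩ := Finset.exists_card_fiber_lt_of_card_lt_mul (s := I)
    (t := Polynomial.nthRootsFinset q (1 : ℂ)) (f := fun x => e x b) (n := m) (by rwa [hcard])
  refine ⟨ω, (hmem ω).1 hω, fun J hJ hJω => (Finset.card_le_card fun x hx => ?_).trans_lt hlt⟩
  exact Finset.mem_filter.2 ⟨hJ hx, hJω x hx⟩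

lemma left_of_card_lt (hpq : p ≠ q) {a b : G} (ha : p • a = 0) (hb : q • b = 0)
    (h : Vanishes I e (a + b)) (hI : I.card < q) : Vanishes I e a := by
  obtain ⟨ω, hω, hJ⟩ := exists_fiber_card_lt (e := e) b (m := 1) (I := I) (by simpa using hI)
  refine h.left_of_fiber_eq_empty hpq ha hb hω fun x hx hxω => ?_
  simpa using hJ {x} (by simpa using hx) (by simpa using hxω)

/-- Some fibre of evaluation at `b` has fewer than `p` elements. Comparing its sums at the multiples
of `a` with those of `I` shows that `p` divides its size, so it is empty; an empty fibre makes the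
whole sum at `a` zero. -/
lemma left_of_dvd_card (hpq : p ≠ q) {a b : G} (ha : p • a = 0) (hb : q • b = 0)
    (h : Vanishes I e (a + b)) (hpI : p ∣ I.card) (hI : I.card < q * p) : Vanishes I e a := by
  classical
  obtain ⟨ω, hω, hJ⟩ := exists_fiber_card_lt (e := e) b (m := p) (I := I) hI
  refine h.left_of_fiber_eq_empty hpq ha hb hω ?_
  set J := I.filter fun x => e x b = ω
  have hlt : J.card < p := hJ J (Finset.filter_subset _ _) fun x hx => (Finset.mem_filter.1 hx).2
  have h1 := sum_range_sum_eq_mul_card J e hp.out.ne_zero ha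
  have h2 := sum_range_sum_eq_mul_card I e hp.out.ne_zero ha
  -- The term `l = 0` is split off because the fibre identity needs a nonzero multiple of `a`.
  obtain ⟨n, hn⟩ : ∃ n, p = n + 1 := ⟨p - 1, (Nat.sub_add_cancel hp.out.one_le).symm⟩
  have h3 : (q : ℂ) * ∑ l ∈ Finset.range n, ∑ x ∈ J, e x ((l + 1) • a) =
      ∑ l ∈ Finset.range n, ∑ x ∈ I, e x ((l + 1) • a) := by
    rw [Finset.mul_sum]
    refine Finset.sum_congr rfl fun l hl => ?_
    have := Finset.mem_range.1 hl
    exact h.mul_sum_fiber hpq ha hb l.succ_pos (by omega) hω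
  have hr (K : Finset X) : ∑ l ∈ Finset.range p, ∑ x ∈ K, e x (l • a) =
      (∑ l ∈ Finset.range n, ∑ x ∈ K, e x ((l + 1) • a)) + K.card := by
    rw [hn, Finset.sum_range_succ']
    simp
  rw [hr] at h1 h2
  -- This is `q * (p * #J₁ - #J) = p * #I₁ - #I`, the subscript marking `e x a = 1`, rearranged to
  -- avoid subtraction in `ℕ`.
  have h4 : q * J.card + p * (I.filter fun x => e x a = 1).card =
      p * (q * (J.filter fun x => e x a = 1).card) + I.card := by
    have : (q : ℂ) * J.card + p * (I.filter fun x => e x a = 1).card =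
      p * (q * (J.filter fun x => e x a = 1).card) + I.card := by
      linear_combination (-1 : ℂ) * h2 + q * h1 - h3
    exact_mod_cast this
  have h5 : p ∣ q * J.card :=
    (Nat.dvd_add_left (dvd_mul_right _ _)).1 (h4 ▸ dvd_add (dvd_mul_right _ _) hpI)
  have h6 : p ∣ J.card :=
    (Nat.Coprime.dvd_mul_left ((Nat.coprime_primes hp.out hq.out).2 hpq)).1 h5
  have h7 : J = ∅ := Finset.card_eq_zero.1 (Nat.eq_zero_of_dvd_of_lt h6 hlt)
  exact fun x hx hxω => Finset.notMem_empty x (h7 ▸ Finset.mem_filter.2 ⟨hx, hxω⟩)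

end Vanishes

/-! ### Duality between a set and its spectrum -/

lemma AddChar.mul_conj_eq_map_sub {G : Type*} [AddCommGroup G] [Finite G] (χ : AddChar G ℂ)
    (x y : G) : χ x * conj (χ y) = χ (x - y) := by
  rw [← AddChar.map_neg_eq_conj, ← AddChar.map_add_eq_mul, sub_eq_add_neg]

/-- A spectrum of `S` is finite, has `#S` elements, and dually the points of `S` are orthogonal
on it. -/
lemma IsSpectrum.exists_dual {G : Type*} [AddCommGroup G] [Finite G] {S : Finset G}
    {L : Set (AddChar G ℂ)} (h : IsSpectrum S L) :
    ∃ I : Finset (AddChar G ℂ), I.card = S.card ∧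
      ∀ s ∈ S, ∀ t ∈ S, s ≠ t → ∑ χ ∈ I, χ (s - t) = 0 := by
  classical
  have : Fintype L := Fintype.ofFinite L
  have hcard : Fintype.card L = Fintype.card S := by
    have h1 := Module.finrank_eq_card_basis
      (Module.Basis.mk h.linearIndependent h.span_eq_top.ge)
    rw [← h1, Module.finrank_pi]
  refine ⟨L.toFinset, by simpa using hcard, fun s hs t ht hst => ?_⟩
  have hS0 : (S.card : ℂ) ≠ 0 := by
    exact_mod_cast (Finset.card_pos.2 ⟨s, hs⟩).ne'
  -- Orthogonality of the rows is `A * B = 1`; as `A` is square, `B * A = 1`, which is orthogonality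
  -- of the columns.
  let A : Matrix L S ℂ := fun χ x => (χ : AddChar G ℂ) x
  let B : Matrix S L ℂ := fun x χ => (S.card : ℂ)⁻¹ * conj ((χ : AddChar G ℂ) x)
  have hAB : A * B = 1 := by
    ext χ ψ
    rw [Matrix.mul_apply, Matrix.one_apply]
    have h1 : ∑ x : S, A χ x * B x ψ =
        (S.card : ℂ)⁻¹ * ∑ x ∈ S, (χ : AddChar G ℂ) x * conj ((ψ : AddChar G ℂ) x) := by
      rw [← Finset.sum_coe_sort S, Finset.mul_sum]
      exact Finset.sum_congr rfl fun x _ => mul_left_comm _ _ _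
    rw [h1]
    split_ifs with hχ
    · subst hχ
      simp [AddChar.mul_conj_eq_map_sub, hS0]
    · rw [h.orthogonal χ χ.2 ψ ψ.2 (fun h => hχ (Subtype.ext h)), mul_zero]
  have hBA : B * A = 1 := (Matrix.mul_eq_one_comm_of_card_eq L S ℂ hcard).1 hAB
  have h2 := congrFun (congrFun hBA ⟨t, ht⟩) ⟨s, hs⟩
  rw [Matrix.mul_apply, Matrix.one_apply_ne (by simpa using hst.symm)] at h2
  have h3 : ∑ χ : L, B ⟨t, ht⟩ χ * A χ ⟨s, hs⟩ =
      (S.card : ℂ)⁻¹ * ∑ χ ∈ L.toFinset, χ (s - t) := by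
    rw [Finset.mul_sum, ← Finset.sum_coe_sort L.toFinset]
    refine Fintype.sum_equiv (Equiv.subtypeEquivRight (by simp)) _ _ fun χ => ?_
    simp only [A, B, Equiv.subtypeEquivRight_apply_coe]
    rw [← AddChar.mul_conj_eq_map_sub]
    ring
  rw [h3] at h2
  exact (mul_eq_zero.1 h2).resolve_left (inv_ne_zero hS0)

/-- As many pairwise orthogonal characters as points form a spectrum. -/
lemma isSpectral_of_orthogonal {G : Type*} [AddCommGroup G] [Finite G] {S : Finset G}
    (hS : S.Nonempty) (I : Finset (AddChar G ℂ)) (hI : I.card = S.card)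
    (h : ∀ χ ∈ I, ∀ ψ ∈ I, χ ≠ ψ → ∑ x ∈ S, χ x * conj (ψ x) = 0) : IsSpectral S := by
  classical
  have hS0 : (S.card : ℂ) ≠ 0 := by
    exact_mod_cast (Finset.card_pos.2 hS).ne'
  have hli : LinearIndependent ℂ
      (fun (χ : (I : Set (AddChar G ℂ))) (x : S) => (χ : AddChar G ℂ) (x : G)) := by
    rw [Fintype.linearIndependent_iff]
    intro c hc ψ
    have h1 : ∑ x : S, (∑ χ, c χ * (χ : AddChar G ℂ) x) * conj ((ψ : AddChar G ℂ) x) = 0 := by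
      refine Finset.sum_eq_zero fun x _ => ?_
      have := congrFun hc x
      simp only [Finset.sum_apply, Pi.smul_apply, smul_eq_mul, Pi.zero_apply] at this
      rw [this, zero_mul]
    simp only [Finset.sum_mul] at h1
    rw [Finset.sum_comm] at h1
    have h2 (χ : (I : Set (AddChar G ℂ))) :
        ∑ x : S, c χ * (χ : AddChar G ℂ) x * conj ((ψ : AddChar G ℂ) x) =
        c χ * ∑ x ∈ S, (χ : AddChar G ℂ) x * conj ((ψ : AddChar G ℂ) x) := by
      rw [← Finset.sum_coe_sort S, Finset.mul_sum]
      exact Finset.sum_congr rfl fun x _ => mul_assoc _ _ _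
    simp only [h2] at h1
    rw [Finset.sum_eq_single ψ] at h1
    · simp only [AddChar.mul_conj_eq_map_sub, sub_self, AddChar.map_zero_eq_one] at h1
      rw [Finset.sum_const, nsmul_one] at h1
      exact (mul_eq_zero.1 h1).resolve_right hS0
    · intro χ _ hχ
      rw [h χ χ.2 ψ ψ.2 (fun h => hχ (Subtype.ext h)), mul_zero]
    · simp
  refine ⟨I, fun χ hχ ψ hψ => h χ hχ ψ hψ, hli, ?_⟩
  exact hli.span_eq_top_of_card_eq_finrank' (by simp [hI])

/-! ### Tilings by subgroups and transforms of tilings -/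

section tiles

variable {G : Type*} [AddCommGroup G] [Fintype G] [DecidableEq G] {S : Finset G}

lemma card_mul_card_le_of_sub_mem (H : AddSubgroup G)
    (h : ∀ s ∈ S, ∀ t ∈ S, s - t ∈ H → s = t) : S.card * Nat.card H ≤ Fintype.card G ∧
      (S.card * Nat.card H = Fintype.card G → IsTile S) := by
  classical
  let T : Finset G := Finset.univ.filter (· ∈ H)
  have hT : T.card = Nat.card H := by
    rw [Nat.card_eq_fintype_card, Fintype.card_subtype]
  have hinj : (S + T).card = S.card * T.card := by
    rw [Finset.card_add_iff]
    rintro ⟨s, a⟩ hs ⟨t, b⟩ ht hst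
    simp only [Set.mem_prod, Finset.mem_coe, T, Finset.mem_filter, Finset.mem_univ,
      true_and] at hs ht hst
    have h1 : s = t := h s hs.1 t ht.1 (by
      rw [show s - t = b - a by rw [sub_eq_sub_iff_add_eq_add, hst, add_comm]]
      exact sub_mem ht.2 hs.2)
    subst h1
    simpa using hst
  rw [hT] at hinj
  refine ⟨hinj ▸ Finset.card_le_univ _, fun hc => ⟨T, ?_, by rw [hT, hc]⟩⟩
  exact (Finset.card_eq_iff_eq_univ _).1 (hinj.trans hc)

lemma sum_mul_sum_eq_zero_of_tiling {T : Finset G} (h : S + T = Finset.univ)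
    (hc : S.card * T.card = Fintype.card G) {χ : AddChar G ℂ} (hχ : χ ≠ 1) :
    (∑ s ∈ S, χ s) * ∑ t ∈ T, χ t = 0 := by
  have hinj := Finset.card_add_iff.1 (show (S + T).card = S.card * T.card by
    rw [h, hc, Finset.card_univ])
  rw [← AddChar.sum_eq_zero_of_ne_one hχ, ← h, Finset.sum_mul_sum, ← Finset.sum_product',
    ← Finset.image_add_product, Finset.sum_image]
  · exact Finset.sum_congr rfl fun x _ => (AddChar.map_add_eq_mul _ _ _).symm
  · simpa using hinj

end tiles

/-! ### Zeros in the product of the plane and the line -/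

section planeTimesLine

variable {p q : ℕ}

lemma nsmul_prod_zero (v : ZMod p × ZMod p) : p • (v, (0 : ZMod q)) = 0 := by
  ext <;> simp

lemma nsmul_zero_prod (c : ZMod q) : q • ((0 : ZMod p × ZMod p), c) = 0 := by
  ext <;> simp

variable [hp : Fact p.Prime] [hq : Fact q.Prime]

lemma card_zmultiples_of_ne_zero {v : ZMod p × ZMod p} (hv : v ≠ 0) :
    Nat.card (AddSubgroup.zmultiples v) = p := by
  rw [Nat.card_zmultiples]
  exact addOrderOf_eq_prime (by ext <;> simp) hv

lemma card_addSubgroup_prod {A B : Type*} [AddGroup A] [AddGroup B] (H : AddSubgroup A)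
    (K : AddSubgroup B) : Nat.card (H.prod K) = Nat.card H * Nat.card K := by
  rw [Nat.card_congr (H.prodEquiv K).toEquiv, Nat.card_prod]

lemma card_plane_prod_line : Fintype.card ((ZMod p × ZMod p) × ZMod q) = p * p * q := by
  simp [ZMod.card]

namespace Vanishes

variable {X : Type*} {I : Finset X} {e : X → AddChar ((ZMod p × ZMod p) × ZMod q) ℂ}

lemma dvd_card_of_left {v : ZMod p × ZMod p} (hv : v ≠ 0) (h : Vanishes I e (v, 0)) :
    p ∣ I.card :=
  h.prime_dvd_card (nsmul_prod_zero v) (by simpa using hv)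

lemma dvd_card_of_right {c : ZMod q} (hc : c ≠ 0) (h : Vanishes I e (0, c)) :
    q ∣ I.card :=
  h.prime_dvd_card (nsmul_zero_prod c) (by simpa using hc)

lemma sq_dvd_card (h : ∀ v : ZMod p × ZMod p, v ≠ 0 → Vanishes I e (v, 0)) :
    p * p ∣ I.card := by
  have h1 := card_dvd (I := I) (e := e) (AddSubgroup.prod ⊤ ⊥) (by
    rintro ⟨v, c⟩ hg hg0
    obtain rfl : c = 0 := by simpa [AddSubgroup.mem_prod] using hg
    exact h v (by rintro rfl; exact hg0 rfl))
  simpa [card_addSubgroup_prod] using h1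

lemma left_generator {v w : ZMod p × ZMod p} (hw : w ∈ AddSubgroup.zmultiples v) (hw0 : w ≠ 0)
    (h : Vanishes I e (w, 0)) : Vanishes I e (v, 0) := by
  refine h.of_mem_zmultiples (nsmul_prod_zero v) ?_ (by simpa using hw0)
  obtain ⟨k, rfl⟩ := hw
  exact ⟨k, by simp⟩

lemma left_of_dvd (hpq : p ≠ q) {v : ZMod p × ZMod p} {c : ZMod q} (h : Vanishes I e (v, c))
    (hpI : p ∣ I.card) (hI : I.card < q * p) : Vanishes I e (v, 0) :=
  left_of_dvd_card hpq (nsmul_prod_zero v) (nsmul_zero_prod c) (by simpa using h) hpI hI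

lemma left_of_lt (hpq : p ≠ q) {v : ZMod p × ZMod p} {c : ZMod q} (h : Vanishes I e (v, c))
    (hI : I.card < q) : Vanishes I e (v, 0) :=
  left_of_card_lt hpq (nsmul_prod_zero v) (nsmul_zero_prod c) (by simpa using h) hI

end Vanishes

/-- Each `H` free of zeros bounds `#S` by `#G / #H`, and divisibility by `p` or `q` bounds it below.
The resulting sizes are `p * p * q`, `p * p`, `p * q`, `p`, `q` and 1. -/
lemma isTile_of_isSpectral (hpq : p ≠ q) {S : Finset ((ZMod p × ZMod p) × ZMod q)}
    (hS : S.Nonempty) (h : IsSpectral S) : IsTile S := by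
  obtain ⟨L, hL⟩ := h
  obtain ⟨I, hI, hdual⟩ := hL.exists_dual
  have hZ : ∀ s ∈ S, ∀ t ∈ S, s ≠ t → Vanishes I id (s - t) := hdual
  have hco : p.Coprime q := (Nat.coprime_primes hp.out hq.out).2 hpq
  have hp0 := hp.out.pos
  have hq0 := hq.out.pos
  have hN := Finset.card_pos.2 hS
  have htile (H : AddSubgroup ((ZMod p × ZMod p) × ZMod q))
      (hH : ∀ v c, (v, c) ∈ H → (v, c) ≠ 0 → ¬ Vanishes I id (v, c)) :
      S.card * Nat.card H ≤ p * p * q ∧ (S.card * Nat.card H = p * p * q → IsTile S) := by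
    rw [← card_plane_prod_line]
    refine card_mul_card_le_of_sub_mem H fun s hs t ht hst => ?_
    by_contra hne
    exact hH _ _ hst (sub_ne_zero.2 hne) (hZ s hs t ht hne)
  -- Otherwise some `x` in the plane is not a zero, and then no nonzero point of its line is.
  by_cases hall : ∀ v : ZMod p × ZMod p, v ≠ 0 → Vanishes I id (v, (0 : ZMod q))
  · have hpp := Vanishes.sq_dvd_card hall
    rw [hI] at hpp
    by_cases hqS : q ∣ S.card
    · obtain ⟨hle, ht⟩ := htile ⊥ fun v c h h0 => absurd h h0
      have hdvd : p * p * q ∣ S.card := (hco.mul_left hco).mul_dvd_of_dvd_of_dvd hpp hqS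
      rw [AddSubgroup.card_bot, mul_one] at hle ht
      exact ht (le_antisymm hle (Nat.le_of_dvd hN hdvd))
    · obtain ⟨hle, ht⟩ := htile (AddSubgroup.prod ⊥ ⊤) (by
        intro v c h h0 hv
        obtain rfl : v = 0 := by simpa [AddSubgroup.mem_prod] using h
        exact hqS (hI ▸ hv.dvd_card_of_right (by rintro rfl; exact h0 rfl)))
      have hH : Nat.card (AddSubgroup.prod (⊥ : AddSubgroup (ZMod p × ZMod p))
          (⊤ : AddSubgroup (ZMod q))) = q := by simp [card_addSubgroup_prod]
      rw [hH] at hle ht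
      refine ht ?_
      rw [le_antisymm (Nat.le_of_mul_le_mul_right hle hq0) (Nat.le_of_dvd hN hpp)]
  · push Not at hall
    obtain ⟨x, hx0, hx⟩ := hall
    by_cases hpS : p ∣ S.card
    · obtain ⟨hle, ht⟩ := htile ((AddSubgroup.zmultiples x).prod ⊥) (by
        intro v c h h0 hv
        rw [AddSubgroup.mem_prod, AddSubgroup.mem_bot] at h
        obtain ⟨hvx, rfl : c = 0⟩ := h
        exact hx (hv.left_generator hvx (by rintro rfl; exact h0 rfl)))
      rw [card_addSubgroup_prod, card_zmultiples_of_ne_zero hx0, AddSubgroup.card_bot,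
        mul_one] at hle ht
      have hle' : S.card ≤ p * q :=
        Nat.le_of_mul_le_mul_right (hle.trans_eq (by ring)) hp0
      by_cases hqS : q ∣ S.card
      · refine ht ?_
        rw [le_antisymm hle' (Nat.le_of_dvd hN (hco.mul_dvd_of_dvd_of_dvd hpS hqS))]
        ring
      · have hlt : S.card < q * p := by
          rw [mul_comm]
          refine lt_of_le_of_ne hle' fun h => hqS (h ▸ dvd_mul_left _ _)
        -- Since `#S < q * p`, a zero above the line of `x` would descend to the line itself.
        obtain ⟨hle, ht⟩ := htile ((AddSubgroup.zmultiples x).prod ⊤) (by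
          intro v c h h0 hv
          have hvx := (AddSubgroup.mem_prod.1 h).1
          by_cases hv0 : v = 0
          · subst hv0
            exact hqS (hI ▸ hv.dvd_card_of_right (by rintro rfl; exact h0 rfl))
          · exact hx ((hv.left_of_dvd hpq (hI ▸ hpS) (hI ▸ hlt)).left_generator hvx hv0))
        rw [card_addSubgroup_prod, card_zmultiples_of_ne_zero hx0, AddSubgroup.card_top,
          Nat.card_zmod] at hle ht
        refine ht ?_
        have : S.card ≤ p :=
          Nat.le_of_mul_le_mul_right (hle.trans_eq (by ring)) (Nat.mul_pos hp0 hq0)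
        rw [le_antisymm this (Nat.le_of_dvd hN hpS)]
        ring
    · obtain ⟨hle, ht⟩ := htile (AddSubgroup.prod ⊤ ⊥) (by
        intro v c h h0 hv
        obtain rfl : c = 0 := by simpa [AddSubgroup.mem_prod] using h
        exact hpS (hI ▸ hv.dvd_card_of_left (by rintro rfl; exact h0 rfl)))
      have hH : Nat.card (AddSubgroup.prod (⊤ : AddSubgroup (ZMod p × ZMod p))
          (⊥ : AddSubgroup (ZMod q))) = p * p := by simp [card_addSubgroup_prod]
      rw [hH] at hle ht
      have hle' : S.card ≤ q :=
        Nat.le_of_mul_le_mul_right (hle.trans_eq (by ring)) (Nat.mul_pos hp0 hp0)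
      by_cases hqS : q ∣ S.card
      · refine ht ?_
        rw [le_antisymm hle' (Nat.le_of_dvd hN hqS)]
        ring
      · have hlt : S.card < q := lt_of_le_of_ne hle' fun h => hqS (by rw [h])
        obtain ⟨hle, ht⟩ := htile ⊤ (by
          intro v c _ h0 hv
          by_cases hv0 : v = 0
          · subst hv0
            exact hqS (hI ▸ hv.dvd_card_of_right (by rintro rfl; exact h0 rfl))
          · exact hpS (hI ▸ (hv.left_of_lt hpq (hI ▸ hlt)).dvd_card_of_left hv0))
        rw [AddSubgroup.card_top, Nat.card_eq_fintype_card, card_plane_prod_line] at hle ht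
        have : S.card ≤ 1 :=
          Nat.le_of_mul_le_mul_right (hle.trans_eq (one_mul _).symm)
            (Nat.mul_pos (Nat.mul_pos hp0 hp0) hq0)
        exact ht (by rw [le_antisymm this hN, one_mul])

/-! ### Tiles are spectral -/

/-- The standard self-duality of `ZMod p × ZMod p × ZMod q`. -/
noncomputable def planeLineChar (s : (ZMod p × ZMod p) × ZMod q) :
    AddChar ((ZMod p × ZMod p) × ZMod q) ℂ where
  toFun a := ZMod.stdAddChar (s.1.1 * a.1.1 + s.1.2 * a.1.2) * ZMod.stdAddChar (s.2 * a.2)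
  map_zero_eq_one' := by simp
  map_add_eq_mul' a b := by
    simp only [Prod.fst_add, Prod.snd_add, mul_add, AddChar.map_add_eq_mul]
    ring

lemma planeLineChar_apply (s a : (ZMod p × ZMod p) × ZMod q) : planeLineChar s a =
    ZMod.stdAddChar (s.1.1 * a.1.1 + s.1.2 * a.1.2) * ZMod.stdAddChar (s.2 * a.2) := rfl

lemma planeLineChar_comm (s a : (ZMod p × ZMod p) × ZMod q) :
    planeLineChar s a = planeLineChar a s := by
  simp only [planeLineChar_apply, mul_comm]

lemma planeLineChar_ne_one {s : (ZMod p × ZMod p) × ZMod q} (hs : s ≠ 0) :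
    planeLineChar s ≠ 1 := by
  intro h
  apply hs
  have key {n : ℕ} [NeZero n] {c : ZMod n} (hc : ZMod.stdAddChar c = 1) : c = 0 :=
    ZMod.injective_stdAddChar (hc.trans (AddChar.map_zero_eq_one _).symm)
  have h1 := DFunLike.congr_fun h ((1, 0), 0)
  have h2 := DFunLike.congr_fun h ((0, 1), 0)
  have h3 := DFunLike.congr_fun h ((0, 0), 1)
  simp only [planeLineChar_apply, mul_one, mul_zero, add_zero, zero_add,
    AddChar.map_zero_eq_one, one_mul, AddChar.one_apply] at h1 h2 h3
  exact Prod.ext (Prod.ext (key h1) (key h2)) (key h3)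

lemma planeLineChar_mul_conj (s t x : (ZMod p × ZMod p) × ZMod q) :
    planeLineChar s x * conj (planeLineChar t x) = planeLineChar x (s - t) := by
  rw [planeLineChar_comm s, planeLineChar_comm t, AddChar.mul_conj_eq_map_sub]

lemma planeLineChar_injective :
    Function.Injective (planeLineChar (p := p) (q := q)) := by
  intro s t h
  by_contra hst
  refine planeLineChar_ne_one (sub_ne_zero.2 hst) (DFunLike.ext _ _ fun x => ?_)
  rw [planeLineChar_comm, ← planeLineChar_mul_conj, h, AddChar.mul_conj_eq_map_sub, sub_self,
    AddChar.map_zero_eq_one, AddChar.one_apply]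

lemma isSpectral_of_vanishes {S : Finset ((ZMod p × ZMod p) × ZMod q)} (hS : S.Nonempty)
    (H : AddSubgroup ((ZMod p × ZMod p) × ZMod q)) (hc : Nat.card H = S.card)
    (h : ∀ g ∈ H, g ≠ 0 → Vanishes S planeLineChar g) : IsSpectral S := by
  classical
  refine isSpectral_of_orthogonal hS
    ((Finset.univ.filter (· ∈ H)).image planeLineChar) ?_ ?_
  · rw [Finset.card_image_of_injective _ planeLineChar_injective, ← hc,
      Nat.card_eq_fintype_card, Fintype.card_subtype]
  · simp only [Finset.mem_image, Finset.mem_filter, Finset.mem_univ, true_and]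
    rintro _ ⟨s, hs, rfl⟩ _ ⟨t, ht, rfl⟩ hst
    simp only [planeLineChar_mul_conj]
    exact h _ (sub_mem hs ht) (sub_ne_zero.2 fun h => hst (by rw [h]))

/-- Here `#T` divides `p ^ 2 * q`, and each of the six divisors admits a subgroup of order `#G / #T`
whose nonzero points are not zeros of `T`; this subgroup is the spectrum of `S`. -/
lemma isSpectral_of_isTile (hpq : p ≠ q) {S : Finset ((ZMod p × ZMod p) × ZMod q)}
    (hS : S.Nonempty) (h : IsTile S) : IsSpectral S := by
  obtain ⟨T, hST, hcard⟩ := h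
  have hp0 := hp.out.pos
  have hq0 := hq.out.pos
  have hqp : ¬ q ∣ p := fun h => hpq ((Nat.prime_dvd_prime_iff_eq hq.out hp.out).1 h).symm
  have hpq' : ¬ p ∣ q := fun h => hpq ((Nat.prime_dvd_prime_iff_eq hp.out hq.out).1 h)
  have hspec (H : AddSubgroup ((ZMod p × ZMod p) × ZMod q))
      (hH : ∀ v c, (v, c) ∈ H → (v, c) ≠ 0 → ¬ Vanishes T planeLineChar (v, c))
      (hc : Nat.card H * T.card = p * p * q) : IsSpectral S := by
    rw [card_plane_prod_line] at hcard
    have hT : 0 < T.card := by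
      refine Nat.pos_of_ne_zero fun h0 => ?_
      rw [h0, mul_zero] at hcard
      exact (Nat.mul_pos (Nat.mul_pos hp0 hp0) hq0).ne hcard
    refine isSpectral_of_vanishes hS H (Nat.eq_of_mul_eq_mul_right hT (hc.trans hcard.symm)) ?_
    rintro ⟨v, c⟩ hg hg0
    have h1 := sum_mul_sum_eq_zero_of_tiling hST
      (by rw [hcard, card_plane_prod_line]) (planeLineChar_ne_one hg0)
    simp only [planeLineChar_comm (v, c)] at h1
    exact (mul_eq_zero.1 h1).resolve_right (hH v c hg hg0)
  have hne : ¬ p * p ∣ T.card → ∃ x : ZMod p × ZMod p, x ≠ 0 ∧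
      ¬ Vanishes T planeLineChar (x, (0 : ZMod q)) := by
    intro h
    by_contra! hall
    exact h (Vanishes.sq_dvd_card hall)
  have hright {c : ZMod q} (h : ¬ q ∣ T.card) (hc : c ≠ 0) :
      ¬ Vanishes T planeLineChar ((0 : ZMod p × ZMod p), c) :=
    fun hv => h (hv.dvd_card_of_right hc)
  have hleft {v : ZMod p × ZMod p} (h : ¬ p ∣ T.card) (hv : v ≠ 0) :
      ¬ Vanishes T planeLineChar (v, (0 : ZMod q)) :=
    fun hv' => h (hv'.dvd_card_of_left hv)
  have hdvd : T.card ∣ p ^ 2 * q := by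
    rw [sq, ← card_plane_prod_line, ← hcard]
    exact dvd_mul_left _ _
  obtain ⟨a, b, ha, hb, hab⟩ := (Nat.dvd_mul).1 hdvd
  obtain ⟨i, hi, rfl⟩ := (Nat.dvd_prime_pow hp.out).1 ha
  have hsq : ¬ p * p ∣ p := fun h =>
    hp.out.one_lt.not_ge (Nat.le_of_mul_le_mul_left
      ((Nat.le_of_dvd hp0 h).trans_eq (mul_one p).symm) hp0)
  rcases (Nat.dvd_prime hq.out).1 hb with rfl | rfl
  · rw [mul_one] at hab
    have hqT : ¬ q ∣ T.card := fun h => hqp (hq.out.dvd_of_dvd_pow (hab ▸ h))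
    interval_cases i
    · rw [pow_zero] at hab
      refine hspec ⊤ ?_ ?_
      · intro v c _ h0 hv
        obtain ⟨t, ht⟩ := Finset.card_eq_one.1 hab.symm
        simp only [Vanishes, ht, Finset.sum_singleton] at hv
        exact (AddChar.val_isUnit _ _).ne_zero hv
      · rw [AddSubgroup.card_top, Nat.card_eq_fintype_card, card_plane_prod_line, ← hab, mul_one]
    · rw [pow_one] at hab
      obtain ⟨x, hx0, hx⟩ := hne (hab ▸ hsq)
      refine hspec ((AddSubgroup.zmultiples x).prod ⊤) ?_ ?_
      · intro v c h h0 hv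
        have hvx := (AddSubgroup.mem_prod.1 h).1
        by_cases hv0 : v = 0
        · subst hv0
          exact hright hqT (by rintro rfl; exact h0 rfl) hv
        -- With `#T = p`, both conditions for descent hold: `p ∣ #T` and `#T < q * p`.
        · refine hx ((hv.left_of_dvd hpq (by rw [← hab]) ?_).left_generator hvx hv0)
          rw [← hab]
          exact lt_mul_of_one_lt_left hp0 hq.out.one_lt
      · rw [card_addSubgroup_prod, card_zmultiples_of_ne_zero hx0, AddSubgroup.card_top,
          Nat.card_zmod, ← hab]
        ring
    · refine hspec (AddSubgroup.prod ⊥ ⊤) ?_ ?_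
      · intro v c h h0
        obtain rfl : v = 0 := by simpa [AddSubgroup.mem_prod] using h
        exact hright hqT (by rintro rfl; exact h0 rfl)
      · rw [card_addSubgroup_prod, ← hab, AddSubgroup.card_bot, AddSubgroup.card_top,
          Nat.card_zmod]
        ring
  · interval_cases i
    · rw [pow_zero, one_mul] at hab
      refine hspec (AddSubgroup.prod ⊤ ⊥) ?_ ?_
      · intro v c h h0
        obtain rfl : c = 0 := by simpa [AddSubgroup.mem_prod] using h
        exact hleft (hab ▸ hpq') (by rintro rfl; exact h0 rfl)
      · rw [card_addSubgroup_prod, ← hab, AddSubgroup.card_bot, AddSubgroup.card_top,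
          Nat.card_prod, Nat.card_zmod, mul_one]
    · rw [pow_one] at hab
      obtain ⟨x, hx0, hx⟩ := hne (fun h => hpq'
        (Nat.dvd_of_mul_dvd_mul_left hp0 (hab ▸ h)))
      refine hspec ((AddSubgroup.zmultiples x).prod ⊥) ?_ ?_
      · intro v c h h0 hv
        rw [AddSubgroup.mem_prod, AddSubgroup.mem_bot] at h
        obtain ⟨hvx, rfl : c = 0⟩ := h
        exact hx (hv.left_generator hvx (by rintro rfl; exact h0 rfl))
      · rw [card_addSubgroup_prod, card_zmultiples_of_ne_zero hx0, AddSubgroup.card_bot, ← hab]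
        ring
    · refine hspec ⊥ (fun v c h h0 => absurd h h0) ?_
      rw [AddSubgroup.card_bot, ← hab]
      ring

end planeTimesLine

theorem theorem1 (p q : ℕ) [Fact p.Prime] [Fact q.Prime] (hpq : p ≠ q)
    (S : Finset ((ZMod p × ZMod p) × ZMod q)) (hS : S.Nonempty) :
    IsSpectral S ↔ IsTile S :=
  ⟨isTile_of_isSpectral hpq hS, isSpectral_of_isTile hpq hS⟩
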